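/- Let $b:\mathbb R\times\{0,1\}\to\mathbb R$ be bounded and jointly measurable, and write $b_-(x)=b(x,0)$, $b_+(x)=b(x,1)$. Let $\lambda_+,\lambda_->0$. For $x\in\mathbb R$ and $z\in\{0,1\}$ let $(X,Z)$ be a switching diffusion started at $(x,z)$: on some probability space, $W$ is a one-dimensional Brownian motion, $Z=(Z_t)_{t\ge0}$ is a càdlàg Markov chain on $\{0,1\}$ independent of $W$ with $Z_0=z$, which leaves the regime $1$ (drift $b_+$) at constant rate $\lambda_+$ and the regime $0$ (drift $b_-$) at constant rate $\lambda_-$, and $X$ is a continuous process, adapted to the completed filtration generated by $W$ and $Z$, with almost surely $$X_t = x+\int_0^t b(X_s,Z_s)\,ds+W_t\qquad\text{for all }t\ge0 .$$ Suppose that there are $r_+,r_->0$ with $b_+(y)\ge r_+$ and $b_-(y)\ge -r_-$ for all $y\in\mathbb R$, and $$\frac{r_+}{\lambda_+}>\frac{r_-}{\lambda_-}.$$ Then there is a constant $c_0>0$, not depending on $(x,z)$, such that: 1. almost surely, $X_t\to\infty$ as $t\to\infty$ and $\displaystyle\liminf_{t\to\infty}\frac{X_t}{t}\ge c_0$; 2.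 for every $\varepsilon>0$ there are $\kappa\in(0,1)$ and $t_0$, not depending on $(x,z)$, such that for all $t\ge t_0$ $$\mathbb P\Bigl(\frac{X_t-x}{t}-c_0<-\varepsilon\Bigr)<\kappa^t<1 .$$ -/

import Mathlib

open MeasureTheory ProbabilityTheory Filter Set
open scoped NNReal ENNReal Topology

universe u

namespace SwitchingDiffusion

variable {Ω : Type*}

/-- The σ-algebra generated by the process `Y` up to time `t`. -/
@[reducible] def past {E : Type*} [MeasurableSpace E] (Y : ℝ≥0 → Ω → E) (t : ℝ≥0) : MeasurableSpace Ω :=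
  ⨆ s : ℝ≥0, ⨆ _ : s ≤ t, MeasurableSpace.comap (Y s) inferInstance

/-- The generator matrix of the switching process on the regimes `0` (drift `b₋`) and `1`
(drift `b₊`). The entry `(i, j)`, `i ≠ j`, is the rate of jumps from `i` to `j`: regime `1` is left
at rate `lamPlus`, and regime `0` is left at rate `lamMinus`. -/
def generator (lamPlus lamMinus : ℝ) : Matrix (Fin 2) (Fin 2) ℝ :=
  !![-lamMinus, lamMinus; lamPlus, -lamPlus]

/-- The transition matrix `exp (t Q)` (exponential in the matrix algebra). -/
noncomputable def transition (Q : Matrix (Fin 2) (Fin 2) ℝ) (t : ℝ≥0) :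
    Matrix (Fin 2) (Fin 2) ℝ :=
  NormedSpace.exp ((t : ℝ) • Q)

/-- `Z` is, under `P`, a continuous-time Markov chain on `{0, 1}` with càdlàg trajectories, started
at `z`, with generator matrix `Q`, that is, with transition matrices `exp (t Q)`. -/
structure IsMarkovChain [MeasurableSpace Ω] (Q : Matrix (Fin 2) (Fin 2) ℝ) (z : Fin 2)
    (Z : ℝ≥0 → Ω → Fin 2) (P : Measure Ω) : Prop where
  measurable : ∀ t, Measurable (Z t)
  init : ∀ᵐ ω ∂P, Z 0 ω = z
  right_cont : ∀ᵐ ω ∂P, ∀ t, ContinuousWithinAt (fun s ↦ Z s ω) (Ici t) t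
  left_lim : ∀ᵐ ω ∂P, ∀ t, ∃ i, Tendsto (fun s ↦ Z s ω) (𝓝[<] t) (𝓝 i)
  markov : ∀ (s t : ℝ≥0) (j : Fin 2),
    P[({ω | Z (s + t) ω = j}.indicator fun _ ↦ (1 : ℝ)) | past Z s]
      =ᵐ[P] fun ω ↦ transition Q t (Z s ω) j

/-- `(X, Z)` is the switching diffusion `dX = b(X, Z) dt + dW`, `X₀ = x`, `Z₀ = z`: `W` is a
Brownian motion, `Z` is an independent two-state Markov chain, and `X` is a continuous process,
adapted to the (completed) filtration generated by `W` and `Z`, which solves the equation in its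
integral form. -/
structure IsSolution [MeasurableSpace Ω] (b : ℝ → Fin 2 → ℝ) (lamPlus lamMinus : ℝ)
    (x : ℝ) (z : Fin 2) (W X : ℝ≥0 → Ω → ℝ) (Z : ℝ≥0 → Ω → Fin 2) (P : Measure Ω) : Prop where
  measurable_noise : ∀ t, Measurable (W t)
  brownian : IsBrownianReal W P
  chain : IsMarkovChain (generator lamPlus lamMinus) z Z P
  indep : IndepFun (fun ω t ↦ W t ω) (fun ω t ↦ Z t ω) P
  adapted : ∀ t, AEStronglyMeasurable[past W t ⊔ past Z t] (X t) P
  continuous : ∀ᵐ ω ∂P, Continuous fun t ↦ X t ω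
  equation : ∀ᵐ ω ∂P, ∀ t : ℝ≥0,
    X t ω = x + (∫ s in (0 : ℝ)..t, b (X s.toNNReal ω) (Z s.toNNReal ω)) + W t ω

end SwitchingDiffusion

/-! Let r be `-rMinus` in regime 0 and `rPlus` in regime 1, and A_t = ∫₀ᵗ r(Z_s) ds. Since r(i) ≤
b(y, i) for all y, the equation gives X_t - x ≥ A_t + W_t, and the dependence of the drift on the
position disappears: only the chain and the noise remain.

The hypothesis on the rates says that r has positive mean m under the stationary law of Z. A
perturbation argument then yields θ, c > 0 and h > 0 with Qh + (c - θr)h < 0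
(`exists_tilt_dissipative`). So E[exp(-θA_t) h(Z_t)] decays like exp(-ct). This is proved in
discrete time, where the Markov property is iterated along a grid of mesh t/n
(`integral_exp_sum_le`), and passed to the limit by Fatou (`lintegral_exp_integral_le`).

With a = c/(2θ), Chernoff gives P(A_t ≤ at) ≤ C exp(-ct/2), and the Gaussian tail gives P(W_t ≤
-at/2) ≤ exp(-a²t/8). A union bound proves the deviation estimate with c₀ = a/2. The almost sure
claims follow from Borel–Cantelli for A at integer times and from W_t/t → 0. -/

namespace SwitchingDiffusion

/-! ### Tilting the generator -/

/-- The matrix exponential has derivative `Q` at time `0`, entrywise. -/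
lemma hasDerivAt_exp_smul_apply (Q : Matrix (Fin 2) (Fin 2) ℝ) (i j : Fin 2) :
    HasDerivAt (fun u : ℝ ↦ NormedSpace.exp (u • Q) i j) (Q i j) 0 := by
  -- The exponential depends on the norm only through the topology, so any algebra norm may be used
  -- to differentiate it.
  let := Matrix.linftyOpNormedRing (n := Fin 2) (α := ℝ)
  let := Matrix.linftyOpNormedAlgebra (n := Fin 2) (R := ℝ) (α := ℝ)
  have h := hasDerivAt_exp_smul_const (𝕂 := ℝ) Q (0 : ℝ)
  rw [zero_smul, NormedSpace.exp_zero, one_mul] at h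
  have h1 := (hasDerivAt_pi.1 h) i
  exact (hasDerivAt_pi.1 h1) j

/-- A strict Lyapunov inequality for the generator gives a contraction of the tilted semigroup over
short times. -/
lemma eventually_sum_transition_le (Q : Matrix (Fin 2) (Fin 2) ℝ) (r h : Fin 2 → ℝ) (θ c : ℝ)
    (hQ : ∀ i, ∑ j, Q i j * h j + (c - θ * r i) * h i < 0) :
    ∀ᶠ d : ℝ≥0 in 𝓝[>] 0, ∀ i,
      ∑ j, transition Q d i j * (Real.exp (-θ * d * r j) * h j) ≤ Real.exp (-c * d) * h i := by
  rw [eventually_all]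
  intro i
  -- F vanishes at 0 and its derivative there is the left side of `hQ`, so F is negative just to the
  -- right of 0.
  set F : ℝ → ℝ := fun u ↦
    ∑ j, NormedSpace.exp (u • Q) i j * (Real.exp (-θ * u * r j) * h j)
      - Real.exp (-c * u) * h i with hF
  have hE : ∀ a : ℝ, HasDerivAt (fun u : ℝ ↦ Real.exp (a * u)) a 0 := fun a ↦ by
    simpa using ((hasDerivAt_id (0 : ℝ)).const_mul a).exp
  have hone : ∀ j, NormedSpace.exp ((0 : ℝ) • Q) i j = (1 : Matrix (Fin 2) (Fin 2) ℝ) i j := by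
    intro j; rw [zero_smul, NormedSpace.exp_zero]
  have hd : HasDerivAt F (∑ j, Q i j * h j + (c - θ * r i) * h i) 0 := by
    have h1 : ∀ j ∈ (Finset.univ : Finset (Fin 2)), HasDerivAt
        (fun u : ℝ ↦ NormedSpace.exp (u • Q) i j * (Real.exp (-θ * u * r j) * h j))
        (Q i j * h j + (1 : Matrix (Fin 2) (Fin 2) ℝ) i j * (-θ * r j * h j)) 0 := by
      intro j _
      have h2 : HasDerivAt (fun u : ℝ ↦ Real.exp (-θ * u * r j)) (-θ * r j) 0 := by
        have := hE (-θ * r j)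
        refine this.congr_of_eventuallyEq (.of_forall fun u ↦ ?_)
        simp only; congr 1; ring
      have h3 := (hasDerivAt_exp_smul_apply Q i j).mul (h2.mul_const (h j))
      rw [hone j] at h3
      refine h3.congr_deriv ?_
      simp
    have h4 := (HasDerivAt.fun_sum h1).sub ((hE (-c)).mul_const (h i))
    refine h4.congr_deriv ?_
    rw [Finset.sum_add_distrib]
    have : ∑ j, (1 : Matrix (Fin 2) (Fin 2) ℝ) i j * (-θ * r j * h j) = -θ * r i * h i := by
      simp [Matrix.one_apply]
    rw [this]; ring
  have hF0 : F 0 = 0 := by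
    simp only [hF, hone]
    simp [Matrix.one_apply]
  have hneg : ∀ᶠ u in 𝓝[>] (0 : ℝ), slope F 0 u < 0 :=
    (hasDerivAt_iff_tendsto_slope.1 hd |>.mono_left
      (nhdsWithin_mono _ fun u (hu : 0 < u) ↦ hu.ne')).eventually_lt_const (hQ i)
  have hcoe : Tendsto (fun d : ℝ≥0 ↦ (d : ℝ)) (𝓝[>] 0) (𝓝[>] 0) := by
    refine tendsto_nhdsWithin_iff.2 ⟨?_, ?_⟩
    · exact (NNReal.continuous_coe.tendsto' 0 0 rfl).mono_left nhdsWithin_le_nhds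
    · filter_upwards [self_mem_nhdsWithin] with d hd
      exact NNReal.coe_pos.2 hd
  filter_upwards [hcoe.eventually hneg, self_mem_nhdsWithin] with d hd hpos
  have hpos' : (0 : ℝ) < d := NNReal.coe_pos.2 hpos
  rw [slope_def_field, hF0, sub_zero, sub_zero, div_neg_iff] at hd
  have : F d < 0 := by
    rcases hd with hd | hd
    · exact absurd hd.2 hpos'.not_gt
    · exact hd.1
  simp only [hF] at this
  simp only [transition]
  linarith

/-- If the stationary drift is positive, then some tilt of the generator is strictly dissipative. -/
lemma exists_tilt_dissipative {lamPlus lamMinus rPlus rMinus : ℝ}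
    (hlamPlus : 0 < lamPlus) (hlamMinus : 0 < lamMinus) (hrPlus : 0 < rPlus) (hrMinus : 0 < rMinus)
    (hr : rMinus / lamMinus < rPlus / lamPlus) :
    ∃ (h : Fin 2 → ℝ) (θ c : ℝ), (∀ i, 0 < h i) ∧ 0 < θ ∧ 0 < c ∧
      ∀ i, ∑ j, generator lamPlus lamMinus i j * h j
        + (c - θ * (![-rMinus, rPlus] : Fin 2 → ℝ) i) * h i < 0 := by
  rw [div_lt_div_iff₀ hlamMinus hlamPlus] at hr
  set L := lamPlus + lamMinus
  have hL : 0 < L := by positivity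
  -- m is the stationary mean of r. The vector f = (0, -D) solves the Poisson equation Qf = r - m;
  -- `e0` and `e1` are its two rows.
  set m := (lamMinus * rPlus - lamPlus * rMinus) / L with hm
  have hm0 : 0 < m := div_pos (by linarith) hL
  set D := (rPlus + rMinus) / L with hD
  have hD0 : 0 < D := by positivity
  have e0 : lamMinus * D = rMinus + m := by rw [hm, hD]; field_simp; ring
  have e1 : lamPlus * D = rPlus - m := by rw [hm, hD]; field_simp; ring
  have hmr : m < rPlus := by nlinarith [mul_pos hlamPlus hD0]
  -- Take h = 1 + θf = (1, 1 - a) with θ = a/D. Then Qh - θrh = -θm - θ²rf. The last term is 0 in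
  -- regime 0, and this a makes it exactly θm/2 in regime 1, which leaves room for c = θm/4.
  set a := m / (2 * rPlus) with ha
  have ha0 : 0 < a := by positivity
  have har : rPlus * a = m / 2 := by rw [ha]; field_simp
  have ha1 : a < 1 := by rw [ha, div_lt_one (by positivity)]; linarith
  have hθ : 0 < a / D := by positivity
  have hθD : a = a / D * D := by field_simp
  set θ := a / D
  refine ⟨![1, 1 - a], θ, θ * m / 4, ?_, hθ, by positivity, ?_⟩
  · intro i; fin_cases i <;> simp [ha1]
  · have p : 0 < θ * m := by positivity
    intro i
    fin_cases i
    · have : lamMinus * a = θ * (rMinus + m) := by rw [← e0]; nth_rewrite 1 [hθD]; ring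
      simp [generator]
      nlinarith
    · have : lamPlus * a = θ * (rPlus - m) := by rw [← e1]; nth_rewrite 1 [hθD]; ring
      have h2 : θ * rPlus * a = θ * m / 2 := by rw [mul_assoc, har]; ring
      simp [generator]
      nlinarith [mul_pos p ha0]

/-! ### Riemann sums of right-continuous paths -/

/-- Right-continuous functions on `ℝ≥0` with bounded values: the right Riemann sums over uniform
partitions of `[0, t]` converge to the integral. -/
lemma tendsto_right_riemann_sum {f : ℝ≥0 → ℝ} {K : ℝ} (hK : ∀ t, |f t| ≤ K)
    (hf : ∀ t, ContinuousWithinAt f (Ici t) t) {t : ℝ≥0} (ht : 0 < t) :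
    (Measurable fun s : ℝ ↦ f s.toNNReal) ∧
    Tendsto (fun n : ℕ ↦ ∑ j ∈ Finset.range n, (t / n : ℝ≥0) * f ((j + 1 : ℕ) * (t / n)))
      atTop (𝓝 (∫ s in (0 : ℝ)..t, f s.toNNReal)) := by
  have ht' : (0 : ℝ) < t := NNReal.coe_pos.2 ht
  -- Rounding s up to the grid approaches it from the right, so right-continuity alone gives
  -- pointwise convergence. For s < 0 both the rounded point and `s.toNNReal` are 0.
  set g : ℕ → ℝ → ℝ := fun n s ↦ f ((⌈s / (t / n)⌉₊ : ℝ≥0) * (t / n)) with hg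
  have hgm : ∀ n, Measurable (g n) := fun n ↦ by
    have : Measurable fun k : ℕ ↦ f ((k : ℝ≥0) * (t / n)) := measurable_of_countable _
    exact this.comp (Nat.measurable_ceil.comp (measurable_id.div_const _))
  have hlim : ∀ s, Tendsto (fun n ↦ g n s) atTop (𝓝 (f s.toNNReal)) := by
    intro s
    refine (hf s.toNNReal).tendsto.comp (tendsto_nhdsWithin_iff.2 ⟨?_, ?_⟩)
    · have hz : Tendsto (fun n : ℕ ↦ t / (n : ℝ≥0)) atTop (𝓝 0) :=
        tendsto_const_div_atTop_nhds_zero_nat t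
      have h1 : Tendsto (fun n : ℕ ↦ s.toNNReal + t / (n : ℝ≥0)) atTop (𝓝 s.toNNReal) := by
        simpa using hz.const_add s.toNNReal
      refine tendsto_of_tendsto_of_tendsto_of_le_of_le' tendsto_const_nhds h1 ?_ ?_
      all_goals
        filter_upwards [eventually_gt_atTop 0] with n hn
        have hn' : (0 : ℝ) < n := by exact_mod_cast hn
        have hq : (0 : ℝ) < t / n := by positivity
      · rw [Real.toNNReal_le_iff_le_coe]
        have := Nat.le_ceil (s / (t / n : ℝ))
        rw [div_le_iff₀ hq] at this
        simpa using this
      · rw [← NNReal.coe_le_coe]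
        push_cast
        rcases le_total 0 s with hs | hs
        · rw [Real.coe_toNNReal _ hs]
          have := (Nat.ceil_lt_add_one (div_nonneg hs hq.le)).le
          calc _ ≤ (s / (t / n : ℝ) + 1) * (t / n) := by gcongr
            _ = _ := by field_simp
        · rw [Nat.ceil_eq_zero.2 (div_nonpos_of_nonpos_of_nonneg hs hq.le)]
          simp; positivity
    · filter_upwards [eventually_gt_atTop 0] with n hn
      have hn' : (0 : ℝ) < n := by exact_mod_cast hn
      have hq : (0 : ℝ) < t / n := by positivity
      rw [mem_Ici, Real.toNNReal_le_iff_le_coe]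
      have := Nat.le_ceil (s / (t / n : ℝ))
      rw [div_le_iff₀ hq] at this
      simpa using this
  refine ⟨measurable_of_tendsto_metrizable hgm (tendsto_pi_nhds.2 hlim), ?_⟩
  have hint : Tendsto (fun n ↦ ∫ s in (0 : ℝ)..t, g n s) atTop
      (𝓝 (∫ s in (0 : ℝ)..t, f s.toNNReal)) := by
    refine intervalIntegral.tendsto_integral_filter_of_dominated_convergence (fun _ ↦ K)
      (.of_forall fun n ↦ (hgm n).aestronglyMeasurable) (.of_forall fun n ↦ .of_forall
        fun s _ ↦ by simpa [hg] using hK _) (by simp) (.of_forall fun s _ ↦ hlim s)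
  refine hint.congr' ?_
  filter_upwards [eventually_gt_atTop 0] with n hn
  have hn' : (0 : ℝ) < n := by exact_mod_cast hn
  set d : ℝ := t / n with hd
  have hq : 0 < d := by positivity
  have hI : ∀ a b : ℝ, IntervalIntegrable (g n) volume a b := fun a b ↦
    intervalIntegrable_const (c := K) |>.mono_fun (hgm n).aestronglyMeasurable
      (.of_forall fun s ↦ by
        simpa [hg] using (hK _).trans (le_abs_self K))
  have hsum := intervalIntegral.sum_integral_adjacent_intervals (f := g n) (μ := volume)
    (a := fun k : ℕ ↦ k * d) (n := n) fun k _ ↦ hI _ _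
  have hnd : (n : ℝ) * d = t := by rw [hd]; field_simp
  rw [hnd] at hsum
  simp only [Nat.cast_zero, zero_mul] at hsum
  rw [← hsum]
  refine Finset.sum_congr rfl fun j _ ↦ ?_
  have hle : (j : ℝ) * d ≤ (j + 1 : ℕ) * d := by gcongr; simp
  have hcongr : ∫ s in (j * d : ℝ)..((j + 1 : ℕ) * d), g n s =
      ∫ _ in (j * d : ℝ)..((j + 1 : ℕ) * d), f ((j + 1 : ℕ) * (t / n)) := by
    refine intervalIntegral.integral_congr_ae (.of_forall fun s hs ↦ ?_)
    rw [uIoc_of_le hle] at hs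
    have : ⌈s / d⌉₊ = j + 1 := by
      rw [Nat.ceil_eq_iff (by simp), lt_div_iff₀ hq, div_le_iff₀ hq]
      simpa using hs
    simp [hg, ← hd, this]
  rw [hcongr, intervalIntegral.integral_const, smul_eq_mul]
  congr 1
  push_cast
  rw [← hd]; ring

/-! ### Exponential moments of additive functionals of the chain -/

section Chain

variable {Ω : Type*}

lemma measurable_past {E : Type*} [MeasurableSpace E] (Y : ℝ≥0 → Ω → E) {s t : ℝ≥0} (h : s ≤ t) :
    Measurable[past Y t] (Y s) :=
  (comap_measurable (Y s)).mono (le_iSup₂_of_le s h le_rfl) le_rfl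

variable [MeasurableSpace Ω] {P : Measure Ω} {Q : Matrix (Fin 2) (Fin 2) ℝ} {z : Fin 2}
  {Z : ℝ≥0 → Ω → Fin 2}

lemma IsMarkovChain.past_le (hZ : IsMarkovChain Q z Z P) (t : ℝ≥0) :
    past Z t ≤ ‹MeasurableSpace Ω› :=
  iSup_le fun s ↦ iSup_le fun _ ↦ (hZ.measurable s).comap_le

/-- The Markov property, integrated against a bounded function of the past. -/
lemma IsMarkovChain.integral_mul_comp [IsProbabilityMeasure P] (hZ : IsMarkovChain Q z Z P)
    (φ : Fin 2 → ℝ) {s : ℝ≥0} (t : ℝ≥0) {Y : Ω → ℝ} (hY : Measurable[past Z s] Y) {K : ℝ}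
    (hK : ∀ ω, |Y ω| ≤ K) :
    ∫ ω, Y ω * φ (Z (s + t) ω) ∂P = ∫ ω, Y ω * ∑ j, transition Q t (Z s ω) j * φ j ∂P := by
  have hm := hZ.past_le s
  have hYi : Integrable Y P :=
    .of_bound (hY.mono hm le_rfl).aestronglyMeasurable K (.of_forall fun ω ↦ hK ω)
  have hset : ∀ j, MeasurableSet {ω | Z (s + t) ω = j} := fun j ↦
    hZ.measurable (s + t) (measurableSet_singleton j)
  have hI : ∀ j, Integrable ({ω | Z (s + t) ω = j}.indicator fun _ ↦ (1 : ℝ)) P := fun j ↦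
    (integrable_const _).indicator (hset j)
  have hYI : ∀ j, Integrable
      (fun ω ↦ Y ω * ({ω | Z (s + t) ω = j}.indicator fun _ ↦ (1 : ℝ)) ω) P := fun j ↦ by
    refine (hYi.indicator (hset j)).congr (.of_forall fun ω ↦ ?_)
    by_cases h : Z (s + t) ω = j <;> simp [indicator, h]
  have htr : ∀ j, Integrable (fun ω ↦ Y ω * transition Q t (Z s ω) j) P := fun j ↦ by
    have : Measurable fun ω ↦ transition Q t (Z s ω) j :=
      (measurable_of_finite fun i ↦ transition Q t i j).comp (hZ.measurable s)
    exact hYi.mul_bdd (c := ∑ i, |transition Q t i j|) this.aestronglyMeasurable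
      (.of_forall fun ω ↦ Finset.single_le_sum (f := fun i ↦ |transition Q t i j|)
        (fun i _ ↦ abs_nonneg _) (Finset.mem_univ (Z s ω)))
  have key : ∀ j, ∫ ω, Y ω * ({ω | Z (s + t) ω = j}.indicator fun _ ↦ (1 : ℝ)) ω ∂P =
      ∫ ω, Y ω * transition Q t (Z s ω) j ∂P := by
    intro j
    have h1 := condExp_mul_of_stronglyMeasurable_left hY.stronglyMeasurable (hYI j) (hI j)
    calc _ = ∫ ω, (P[Y * {ω | Z (s + t) ω = j}.indicator fun _ ↦ (1 : ℝ) | past Z s]) ω ∂P :=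
          (integral_condExp hm).symm
      _ = _ := integral_congr_ae (by
          filter_upwards [h1, hZ.markov s t j] with ω h2 h3
          rw [h2, Pi.mul_apply, h3])
  have e1 : ∀ ω, Y ω * φ (Z (s + t) ω) =
      ∑ j, φ j * (Y ω * ({ω | Z (s + t) ω = j}.indicator fun _ ↦ (1 : ℝ)) ω) := by
    intro ω
    simp [indicator, mul_comm]
  have e2 : ∀ ω, Y ω * ∑ j, transition Q t (Z s ω) j * φ j =
      ∑ j, φ j * (Y ω * transition Q t (Z s ω) j) := by
    intro ω
    rw [Finset.mul_sum]
    exact Finset.sum_congr rfl fun j _ ↦ by ring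
  simp_rw [e1, e2]
  calc _ = ∑ j, φ j * ∫ ω, Y ω * ({ω | Z (s + t) ω = j}.indicator fun _ ↦ (1 : ℝ)) ω ∂P := by
        rw [integral_finsetSum _ fun j _ ↦ (hYI j).const_mul (φ j)]
        exact Finset.sum_congr rfl fun j _ ↦ integral_const_mul _ _
    _ = ∑ j, φ j * ∫ ω, Y ω * transition Q t (Z s ω) j ∂P := by simp_rw [key]
    _ = _ := by
        refine Eq.symm ((integral_finsetSum _ fun j _ ↦ (htr j).const_mul (φ j)).trans ?_)
        exact Finset.sum_congr rfl fun j _ ↦ integral_const_mul _ _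

/-- Exponential moments of the right Riemann sums of an additive functional of the chain. -/
lemma IsMarkovChain.integral_exp_sum_le [IsProbabilityMeasure P] (hZ : IsMarkovChain Q z Z P)
    {r h : Fin 2 → ℝ} {θ c : ℝ} (hθ : 0 ≤ θ) {d : ℝ≥0}
    (hstep : ∀ i, ∑ j, transition Q d i j * (Real.exp (-θ * d * r j) * h j)
      ≤ Real.exp (-c * d) * h i) (n : ℕ) :
    ∫ ω, Real.exp (-θ * ∑ j ∈ Finset.range n, d * r (Z ((j + 1 : ℕ) * d) ω)) * h (Z (n * d) ω) ∂P
      ≤ Real.exp (-c * d * n) * h z := by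
  induction n with
  | zero =>
    simp only [Finset.range_zero, Finset.sum_empty, mul_zero, Real.exp_zero, one_mul,
      Nat.cast_zero, zero_mul]
    rw [integral_congr_ae (g := fun _ ↦ h z) (by filter_upwards [hZ.init] with ω hω; rw [hω])]
    simp
  | succ n ih =>
    set Y : Ω → ℝ := fun ω ↦
      Real.exp (-θ * ∑ j ∈ Finset.range n, d * r (Z ((j + 1 : ℕ) * d) ω)) with hYdef
    -- All sampling times in Y are at most n * d, so conditioning at n * d leaves only the last
    -- factor, to which `hstep` applies.
    have hY : Measurable[past Z (n * d)] Y := by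
      refine Real.measurable_exp.comp (measurable_const.mul
        (Finset.measurable_fun_sum _ fun j hj ↦ measurable_const.mul ?_))
      refine (measurable_of_finite r).comp (measurable_past Z ?_)
      gcongr
      exact_mod_cast Finset.mem_range.1 hj
    set R := ∑ i, |r i|
    have hR : ∀ i, |r i| ≤ R := fun i ↦
      Finset.single_le_sum (f := fun i ↦ |r i|) (fun i _ ↦ abs_nonneg _) (Finset.mem_univ i)
    have hYK : ∀ ω, |Y ω| ≤ Real.exp (θ * ∑ j ∈ Finset.range n, d * R) := by
      intro ω
      rw [hYdef, abs_of_pos (Real.exp_pos _), Real.exp_le_exp, neg_mul, ← mul_neg,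
        ← Finset.sum_neg_distrib]
      gcongr with j hj
      rw [← mul_neg]
      gcongr
      exact (neg_le_abs _).trans (hR _)
    have hYi : Integrable Y P :=
      .of_bound (hY.mono (hZ.past_le _) le_rfl).aestronglyMeasurable _
        (.of_forall fun ω ↦ hYK ω)
    have hbd : ∀ (φ : Fin 2 → ℝ), Integrable (fun ω ↦ Y ω * φ (Z (n * d) ω)) P := fun φ ↦
      hYi.mul_bdd (c := ∑ i, |φ i|)
        ((measurable_of_finite φ).comp (hZ.measurable _)).aestronglyMeasurable
        (.of_forall fun ω ↦ Finset.single_le_sum (f := fun i ↦ |φ i|)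
          (fun i _ ↦ abs_nonneg _) (Finset.mem_univ _))
    have hsucc : ((n + 1 : ℕ) : ℝ≥0) * d = n * d + d := by push_cast; ring
    calc _ = ∫ ω, Y ω * (fun i ↦ Real.exp (-θ * d * r i) * h i) (Z (n * d + d) ω) ∂P := by
          refine integral_congr_ae (.of_forall fun ω ↦ ?_)
          simp only [Finset.sum_range_succ, hsucc, mul_add, Real.exp_add, hYdef, ← mul_assoc]
      _ = ∫ ω, Y ω * ∑ j, transition Q d (Z (n * d) ω) j * (Real.exp (-θ * d * r j) * h j) ∂P :=
          hZ.integral_mul_comp (fun i ↦ Real.exp (-θ * d * r i) * h i) d hY hYK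
      _ ≤ ∫ ω, Real.exp (-c * d) * (Y ω * h (Z (n * d) ω)) ∂P := by
          refine integral_mono
            (hbd fun i ↦ ∑ j, transition Q d i j * (Real.exp (-θ * d * r j) * h j))
            ((hbd h).const_mul _) fun ω ↦ ?_
          calc _ ≤ Y ω * (Real.exp (-c * d) * h (Z (n * d) ω)) :=
                mul_le_mul_of_nonneg_left (hstep _) (Real.exp_pos _).le
            _ = _ := by ring
      _ ≤ Real.exp (-c * d) * (Real.exp (-c * d * n) * h z) := by
          rw [integral_const_mul]; gcongr
      _ = _ := by
          rw [← mul_assoc, ← Real.exp_add]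
          congr 2
          push_cast
          ring

/-- Along almost every trajectory, right Riemann sums of `r (Z s)` converge to the integral. -/
lemma IsMarkovChain.ae_tendsto_riemann_sum (hZ : IsMarkovChain Q z Z P) (r : Fin 2 → ℝ) :
    ∀ᵐ ω ∂P, ∀ t : ℝ≥0, 0 < t → (Measurable fun s : ℝ ↦ r (Z s.toNNReal ω)) ∧
      Tendsto (fun n : ℕ ↦ ∑ j ∈ Finset.range n,
        (t / n : ℝ≥0) * r (Z ((j + 1 : ℕ) * (t / n)) ω)) atTop
        (𝓝 (∫ s in (0 : ℝ)..t, r (Z s.toNNReal ω))) := by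
  filter_upwards [hZ.right_cont] with ω hω t ht
  refine tendsto_right_riemann_sum (f := fun s ↦ r (Z s ω)) (K := ∑ i, |r i|) (fun s ↦ ?_)
    (fun s ↦ ?_) ht
  · exact Finset.single_le_sum (f := fun i ↦ |r i|) (fun i _ ↦ abs_nonneg _) (Finset.mem_univ _)
  · exact (continuous_of_discreteTopology (f := r)).continuousAt.comp_continuousWithinAt (hω s)

/-- Exponential decay of the Laplace transform of the additive functional `∫₀ᵗ r (Z s) ds`. -/
lemma IsMarkovChain.lintegral_exp_integral_le [IsProbabilityMeasure P] (hZ : IsMarkovChain Q z Z P)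
    {r h : Fin 2 → ℝ} {θ c η : ℝ} (hθ : 0 ≤ θ) (hη : 0 < η) (hh : ∀ i, η ≤ h i)
    (hstep : ∀ᶠ d : ℝ≥0 in 𝓝[>] 0, ∀ i,
      ∑ j, transition Q d i j * (Real.exp (-θ * d * r j) * h j) ≤ Real.exp (-c * d) * h i)
    {t : ℝ≥0} (ht : 0 < t) :
    AEMeasurable (fun ω ↦ ∫ s in (0 : ℝ)..t, r (Z s.toNNReal ω)) P ∧
    ∫⁻ ω, ENNReal.ofReal (Real.exp (-θ * ∫ s in (0 : ℝ)..t, r (Z s.toNNReal ω))) ∂P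
      ≤ ENNReal.ofReal (h z / η * Real.exp (-c * t)) := by
  set S : ℕ → Ω → ℝ := fun n ω ↦
    ∑ j ∈ Finset.range n, (t / n : ℝ≥0) * r (Z ((j + 1 : ℕ) * (t / n)) ω) with hS
  have hSm : ∀ n, Measurable (S n) := fun n ↦
    Finset.measurable_fun_sum _ fun j _ ↦ measurable_const.mul
      ((measurable_of_finite r).comp (hZ.measurable _))
  have hlim : ∀ᵐ ω ∂P, Tendsto (fun n ↦ S n ω) atTop
      (𝓝 (∫ s in (0 : ℝ)..t, r (Z s.toNNReal ω))) := by
    filter_upwards [hZ.ae_tendsto_riemann_sum r] with ω hω using (hω t ht).2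
  -- Measurability in ω of the time integral comes from the Riemann sums, with no joint
  -- measurability of Z.
  refine ⟨aemeasurable_of_tendsto_metrizable_ae atTop (fun n ↦ (hSm n).aemeasurable) hlim, ?_⟩
  have hd : Tendsto (fun n : ℕ ↦ t / (n : ℝ≥0)) atTop (𝓝[>] 0) := by
    refine tendsto_nhdsWithin_iff.2 ⟨tendsto_const_div_atTop_nhds_zero_nat t, ?_⟩
    filter_upwards [eventually_gt_atTop 0] with n hn
    exact div_pos ht (by exact_mod_cast hn)
  have hbound : ∀ᶠ n in atTop, ∫⁻ ω, ENNReal.ofReal (Real.exp (-θ * S n ω)) ∂P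
      ≤ ENNReal.ofReal (h z / η * Real.exp (-c * t)) := by
    filter_upwards [hd.eventually hstep, eventually_gt_atTop 0] with n hn hn0
    have hn' : (n : ℝ) ≠ 0 := by exact_mod_cast hn0.ne'
    have hR : ∀ i, |r i| ≤ ∑ i, |r i| := fun i ↦
      Finset.single_le_sum (f := fun i ↦ |r i|) (fun i _ ↦ abs_nonneg _) (Finset.mem_univ i)
    have hbd : ∀ ω, |Real.exp (-θ * S n ω)| ≤
        Real.exp (θ * ∑ j ∈ Finset.range n, ((t / n : ℝ≥0) : ℝ) * ∑ i, |r i|) := by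
      intro ω
      rw [abs_of_pos (Real.exp_pos _), Real.exp_le_exp, neg_mul, ← mul_neg, hS,
        ← Finset.sum_neg_distrib]
      gcongr with j hj
      rw [← mul_neg]
      gcongr
      exact (neg_le_abs _).trans (hR _)
    have hint : Integrable (fun ω ↦ Real.exp (-θ * S n ω)) P :=
      .of_bound (by fun_prop) _ (.of_forall fun ω ↦ hbd ω)
    rw [← ofReal_integral_eq_lintegral_ofReal hint (.of_forall fun ω ↦ (Real.exp_pos _).le)]
    refine ENNReal.ofReal_le_ofReal ?_
    have hmain := hZ.integral_exp_sum_le hθ hn n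
    have hexp : -c * ((t / n : ℝ≥0) : ℝ) * n = -c * t := by push_cast; field_simp
    rw [hexp] at hmain
    have hint2 : Integrable (fun ω ↦ Real.exp (-θ * S n ω) * h (Z (n * (t / n)) ω)) P :=
      hint.mul_bdd (c := ∑ i, |h i|)
        ((measurable_of_finite h).comp (hZ.measurable _)).aestronglyMeasurable
        (.of_forall fun ω ↦ Finset.single_le_sum (f := fun i ↦ |h i|)
          (fun i _ ↦ abs_nonneg _) (Finset.mem_univ _))
    -- The lower bound η ≤ h removes the terminal weight h(Z_t) at the cost of the factor 1/η.
    rw [div_mul_eq_mul_div, le_div_iff₀ hη, ← integral_mul_const]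
    calc _ ≤ ∫ ω, Real.exp (-θ * S n ω) * h (Z (n * (t / n)) ω) ∂P :=
          integral_mono (hint.mul_const _) hint2 fun ω ↦
            mul_le_mul_of_nonneg_left (hh _) (Real.exp_pos _).le
      _ ≤ _ := hmain.trans_eq (mul_comm _ _)
  calc _ = ∫⁻ ω, liminf (fun n ↦ ENNReal.ofReal (Real.exp (-θ * S n ω))) atTop ∂P := by
        refine lintegral_congr_ae ?_
        filter_upwards [hlim] with ω hω
        refine (Tendsto.liminf_eq ?_).symm
        exact (ENNReal.continuous_ofReal.tendsto _).comp
          ((Real.continuous_exp.tendsto _).comp (hω.const_mul _))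
    _ ≤ liminf (fun n ↦ ∫⁻ ω, ENNReal.ofReal (Real.exp (-θ * S n ω)) ∂P) atTop :=
        lintegral_liminf_le fun n ↦ by fun_prop
    _ ≤ _ := liminf_le_of_frequently_le' hbound.frequently

/-- Chernoff bound for the additive functional `∫₀ᵗ r (Z s) ds`. -/
lemma IsMarkovChain.measureReal_integral_le [IsProbabilityMeasure P] (hZ : IsMarkovChain Q z Z P)
    {r h : Fin 2 → ℝ} {θ c η : ℝ} (hθ : 0 < θ) (hη : 0 < η) (hh : ∀ i, η ≤ h i)
    (hstep : ∀ᶠ d : ℝ≥0 in 𝓝[>] 0, ∀ i,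
      ∑ j, transition Q d i j * (Real.exp (-θ * d * r j) * h j) ≤ Real.exp (-c * d) * h i)
    {t : ℝ≥0} (ht : 0 < t) (a : ℝ) :
    P.real {ω | ∫ s in (0 : ℝ)..t, r (Z s.toNNReal ω) ≤ a}
      ≤ h z / η * Real.exp (θ * a - c * t) := by
  obtain ⟨hA, hle⟩ := hZ.lintegral_exp_integral_le hθ.le hη hh hstep ht
  set A : Ω → ℝ := fun ω ↦ ∫ s in (0 : ℝ)..t, r (Z s.toNNReal ω)
  have hpos : 0 ≤ h z / η := div_nonneg (hη.le.trans (hh z)) hη.le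
  refine ENNReal.toReal_le_of_le_ofReal (by positivity) ?_
  have hmk := meas_ge_le_lintegral_div (μ := P)
    (f := fun ω ↦ ENNReal.ofReal (Real.exp (-θ * A ω))) (by fun_prop)
    (ε := ENNReal.ofReal (Real.exp (-θ * a)))
    (ENNReal.ofReal_pos.2 (Real.exp_pos _)).ne' ENNReal.ofReal_ne_top
  have hset : {ω | A ω ≤ a} ⊆
      {ω | ENNReal.ofReal (Real.exp (-θ * a)) ≤ ENNReal.ofReal (Real.exp (-θ * A ω))} := by
    intro ω (hω : A ω ≤ a)
    refine ENNReal.ofReal_le_ofReal (Real.exp_le_exp.2 ?_)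
    nlinarith
  calc P {ω | A ω ≤ a} ≤ _ := measure_mono hset
    _ ≤ _ := hmk
    _ ≤ ENNReal.ofReal (h z / η * Real.exp (-c * t)) / ENNReal.ofReal (Real.exp (-θ * a)) := by
        gcongr
    _ = _ := by
        rw [← ENNReal.ofReal_div_of_pos (Real.exp_pos _), mul_div_assoc, ← Real.exp_sub]
        ring_nf

end Chain

/-! ### Brownian tail and law of large numbers -/

section Noise

variable {Ω : Type*} [MeasurableSpace Ω] {P : Measure Ω} {W : ℝ≥0 → Ω → ℝ}

/-- Gaussian tail bound for Brownian motion at the scale of a linear drift. -/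
lemma measureReal_brownian_le [IsProbabilityMeasure P] (hW : IsPreBrownianReal W P) (t : ℝ≥0)
    {a : ℝ} (ha : 0 ≤ a) : P.real {ω | W t ω ≤ -a * t} ≤ Real.exp (-a ^ 2 / 2 * t) := by
  have hmap := (hW.hasLaw_eval t).map_eq
  have hint : Integrable (fun ω ↦ Real.exp (-a * W t ω)) P := by
    rw [← mgf_pos_iff (X := W t) (t := -a), mgf_gaussianReal hmap]
    positivity
  have h := measure_le_le_exp_mul_mgf (μ := P) (X := W t) (-a * t) (neg_nonpos.2 ha) hint
  refine h.trans_eq ?_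
  rw [mgf_gaussianReal hmap, ← Real.exp_add]
  congr 1
  ring

/-- The law of large numbers for Brownian motion, through time inversion. -/
lemma ae_tendsto_brownian_div [IsProbabilityMeasure P] (hW : IsBrownianReal W P)
    (hm : ∀ t, Measurable (W t)) :
    ∀ᵐ ω ∂P, Tendsto (fun t : ℝ≥0 ↦ W t ω / t) atTop (𝓝 0) := by
  set C : ℝ≥0 → Ω → ℝ := fun t ω ↦ t * W (1 / t) ω with hC
  have hCm : ∀ t, Measurable (C t) := fun t ↦ (hm _).const_mul _
  have hWp : Measurable fun ω ↦ (W · ω) := measurable_pi_lambda _ hm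
  have hCp : Measurable fun ω ↦ (C · ω) := measurable_pi_lambda _ hCm
  have hlaw : P.map (fun ω ↦ (C · ω)) = P.map (fun ω ↦ (W · ω)) := by
    rw [map_eq_iff_forall_finset_map_restrict_eq hCp.aemeasurable hWp.aemeasurable]
    intro I
    rw [(hW.toIsPreBrownianReal.inv.hasLaw I).map_eq, (hW.hasLaw I).map_eq]
  set D := TopologicalSpace.denseSeq ℝ≥0
  -- Convergence to 0 at time 0, tested on a countable dense set: this makes it an event of the
  -- product σ-algebra, so equality of laws carries it from W to its time inversion C. Path
  -- continuity later recovers the other times.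
  set G : Set (ℝ≥0 → ℝ) := {f | ∀ n : ℕ, ∃ m : ℕ, ∀ k : ℕ, D k ∈ Ioo 0 (1 / ((m : ℝ≥0) + 1)) →
    |f (D k)| ≤ 1 / (n + 1)} with hG
  have hGm : MeasurableSet G := by
    simp only [hG, ofPred_forall, ofPred_exists]
    refine .iInter fun n ↦ .iUnion fun m ↦ .iInter fun k ↦ .iInter fun _ ↦ ?_
    exact measurableSet_le (by fun_prop) measurable_const
  have hWG : ∀ᵐ f ∂(P.map fun ω ↦ (W · ω)), f ∈ G := by
    rw [ae_map_iff (p := (· ∈ G)) hWp.aemeasurable hGm]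
    filter_upwards [hW.tendsto_nhds_zero] with ω hω n
    obtain ⟨δ, hδ, hb⟩ := Metric.tendsto_nhds_nhds.1 hω (1 / (n + 1)) (by positivity)
    obtain ⟨m, hm⟩ := exists_nat_one_div_lt hδ
    refine ⟨m, fun k hk ↦ ?_⟩
    have := hb (x := D k) (by
      rw [NNReal.dist_eq, NNReal.coe_zero, sub_zero, abs_of_nonneg (NNReal.coe_nonneg _)]
      refine lt_trans ?_ hm
      exact_mod_cast hk.2)
    simpa using this.le
  rw [← hlaw, ae_map_iff (p := (· ∈ G)) hCp.aemeasurable hGm] at hWG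
  filter_upwards [hWG, hW.cont] with ω hω hcont
  rw [Metric.tendsto_atTop]
  intro ε hε
  obtain ⟨n, hn⟩ := exists_nat_one_div_lt hε
  obtain ⟨m, hm⟩ := hω n
  -- The 2 makes the inequality 1/t < 1/(m + 1) strict, as the open interval U requires.
  refine ⟨(m : ℝ≥0) + 2, fun t ht ↦ ?_⟩
  have ht0 : 0 < t := lt_of_lt_of_le (by positivity) ht
  set U : Set ℝ≥0 := Ioo 0 (1 / (m + 1))
  have hu : 1 / t ∈ U := by
    refine ⟨by positivity, ?_⟩
    refine one_div_lt_one_div_of_lt (by positivity) (lt_of_lt_of_le ?_ ht)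
    gcongr
    norm_num
  have hcl : 1 / t ∈ closure (U ∩ range D) :=
    (TopologicalSpace.denseRange_denseSeq ℝ≥0).open_subset_closure_inter isOpen_Ioo hu
  have hcontAt : ContinuousAt (fun u ↦ C u ω) (1 / t) := by
    refine NNReal.continuous_coe.continuousAt.mul (hcont.continuousAt.comp ?_)
    exact (continuousAt_const.div continuousAt_id hu.1.ne')
  have hle : C (1 / t) ω ∈ {y : ℝ | |y| ≤ 1 / (n + 1)} := by
    refine closure_minimal ?_ (isClosed_le continuous_abs continuous_const)
      (mem_closure_image (f := fun u ↦ C u ω) hcontAt hcl)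
    rintro _ ⟨_, ⟨hk, k, rfl⟩, rfl⟩
    exact hm k hk
  rw [Real.dist_eq, sub_zero]
  refine lt_of_le_of_lt ?_ hn
  have : C (1 / t) ω = W t ω / t := by
    simp [hC]; ring
  rwa [mem_ofPred_eq, this] at hle

end Noise

/-! ### Growth of the additive functional and comparison with X -/

section Diffusion

variable {Ω : Type*} [MeasurableSpace Ω] {P : Measure Ω} {Q : Matrix (Fin 2) (Fin 2) ℝ}
  {x : ℝ} {z : Fin 2} {W X : ℝ≥0 → Ω → ℝ} {Z : ℝ≥0 → Ω → Fin 2}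

/-- Linear growth of the additive functional `∫₀ᵗ r (Z s) ds` along almost every trajectory. -/
lemma IsMarkovChain.ae_eventually_le_integral [IsProbabilityMeasure P]
    (hZ : IsMarkovChain Q z Z P) {r h : Fin 2 → ℝ} {θ c η : ℝ} (hθ : 0 < θ) (hc : 0 < c)
    (hη : 0 < η) (hh : ∀ i, η ≤ h i)
    (hstep : ∀ᶠ d : ℝ≥0 in 𝓝[>] 0, ∀ i,
      ∑ j, transition Q d i j * (Real.exp (-θ * d * r j) * h j) ≤ Real.exp (-c * d) * h i) :
    ∃ M : ℝ, ∀ᵐ ω ∂P, ∀ᶠ t : ℝ≥0 in atTop,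
      c / (2 * θ) * t - M ≤ ∫ s in (0 : ℝ)..t, r (Z s.toNNReal ω) := by
  set a := c / (2 * θ) with ha
  have ha0 : 0 < a := by positivity
  set R := ∑ i, |r i|
  have hR : ∀ i, |r i| ≤ R := fun i ↦
    Finset.single_le_sum (f := fun i ↦ |r i|) (fun i _ ↦ abs_nonneg _) (Finset.mem_univ i)
  -- Borel–Cantelli runs over the times n + 1, because the Chernoff bound needs a positive time. At
  -- level a = c/(2θ) its exponent is -(c/2)(n + 1).
  set E : ℕ → Set Ω := fun n ↦
    {ω | ∫ s in (0 : ℝ)..((n + 1 : ℕ) : ℝ≥0), r (Z s.toNNReal ω) ≤ a * ((n + 1 : ℕ) : ℝ≥0)}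
  have hE : ∀ n, P (E n) ≤ ENNReal.ofReal
      (h z / η * Real.exp (-(c / 2)) * Real.exp (-(c / 2)) ^ n) := by
    intro n
    rw [← ofReal_measureReal]
    refine ENNReal.ofReal_le_ofReal ?_
    refine (hZ.measureReal_integral_le hθ hη hh hstep (t := ((n + 1 : ℕ) : ℝ≥0))
      (by positivity) _).trans_eq ?_
    rw [mul_assoc, ← Real.exp_nat_mul, ← Real.exp_add]
    congr 2
    push_cast
    rw [ha]
    field_simp
    ring
  have hsum : ∑' n, P (E n) ≠ ∞ := by
    have hs : Summable fun n : ℕ ↦ h z / η * Real.exp (-(c / 2)) * Real.exp (-(c / 2)) ^ n :=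
      (summable_geometric_of_lt_one (Real.exp_pos _).le
        (Real.exp_lt_one_iff.2 (by linarith))).mul_left _
    exact ne_top_of_le_ne_top hs.tsum_ofReal_ne_top (ENNReal.tsum_le_tsum hE)
  -- Passing from ⌊t⌋ to t costs at most a in the linear term and at most R in the integral.
  refine ⟨a + R, ?_⟩
  filter_upwards [ae_eventually_notMem hsum, hZ.ae_tendsto_riemann_sum r] with ω hω hmeas
  have hm : Measurable fun s : ℝ ↦ r (Z s.toNNReal ω) := (hmeas 1 one_pos).1
  have hI : ∀ u v : ℝ, IntervalIntegrable (fun s ↦ r (Z s.toNNReal ω)) volume u v := fun u v ↦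
    intervalIntegrable_const (c := R) |>.mono_fun hm.aestronglyMeasurable
      (.of_forall fun s ↦ by simpa using (hR _).trans (le_abs_self R))
  obtain ⟨N, hN⟩ := eventually_atTop.1 hω
  filter_upwards [eventually_ge_atTop ((N + 1 : ℕ) : ℝ≥0)] with t ht
  have hfl : N + 1 ≤ ⌊t⌋₊ := Nat.le_floor ht
  obtain ⟨k, hk⟩ : ∃ k, ⌊t⌋₊ = k + 1 := ⟨⌊t⌋₊ - 1, by omega⟩
  have h1 : a * ((k + 1 : ℕ) : ℝ) < ∫ s in (0 : ℝ)..((k + 1 : ℕ) : ℝ), r (Z s.toNNReal ω) := by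
    have := hN k (by omega)
    simpa [E] using this
  have hle : ((k + 1 : ℕ) : ℝ) ≤ t := by
    rw [← hk]; exact_mod_cast Nat.floor_le zero_le
  have hlt : (t : ℝ) < (k + 1 : ℕ) + 1 := by
    rw [← hk]; exact_mod_cast Nat.lt_floor_add_one t
  have h2 := intervalIntegral.norm_integral_le_of_norm_le_const (a := ((k + 1 : ℕ) : ℝ))
    (b := (t : ℝ)) (C := R) (f := fun s ↦ r (Z s.toNNReal ω)) fun s _ ↦ hR _
  rw [Real.norm_eq_abs, abs_of_nonneg (sub_nonneg.2 hle)] at h2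
  have h3 := intervalIntegral.integral_add_adjacent_intervals (hI 0 ((k + 1 : ℕ) : ℝ))
    (hI ((k + 1 : ℕ) : ℝ) t)
  have h4 := neg_le_of_abs_le h2
  have hR0 : 0 ≤ R := Finset.sum_nonneg fun i _ ↦ abs_nonneg _
  have h5 : R * (t - (k + 1 : ℕ)) ≤ R := by nlinarith
  have h6 : a * (t - 1) ≤ a * (k + 1 : ℕ) := by gcongr; linarith
  linarith

/-- The position of the diffusion dominates an additive functional of the chain plus the noise. -/
lemma IsSolution.ae_integral_add_le {b : ℝ → Fin 2 → ℝ} {lamPlus lamMinus : ℝ}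
    (hS : IsSolution b lamPlus lamMinus x z W X Z P) (hb_meas : Measurable (Function.uncurry b))
    {K : ℝ} (hK : ∀ y i, |b y i| ≤ K) {r : Fin 2 → ℝ} (hr : ∀ y i, r i ≤ b y i) :
    ∀ᵐ ω ∂P, ∀ t : ℝ≥0, x + (∫ s in (0 : ℝ)..t, r (Z s.toNNReal ω)) + W t ω ≤ X t ω := by
  filter_upwards [hS.equation, hS.continuous, hS.chain.ae_tendsto_riemann_sum r,
    hS.chain.ae_tendsto_riemann_sum (fun i ↦ (i : ℝ))] with ω heq hcont hrm hid t
  have hX : Measurable fun s : ℝ ↦ X s.toNNReal ω := hcont.measurable.comp measurable_real_toNNReal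
  -- Embedding the regimes in ℝ makes the path a limit of step functions, hence measurable in s.
  have hZ : Measurable fun s : ℝ ↦ Z s.toNNReal ω := by
    have h1 : Measurable fun s : ℝ ↦ ((Z s.toNNReal ω : Fin 2) : ℝ) := (hid 1 one_pos).1
    refine measurable_to_countable' fun i ↦ ?_
    have : (fun s : ℝ ↦ Z s.toNNReal ω) ⁻¹' {i} =
        (fun s : ℝ ↦ ((Z s.toNNReal ω : Fin 2) : ℝ)) ⁻¹' {(i : ℝ)} := by
      ext s
      simp [Fin.ext_iff]
    rw [this]
    exact h1 (measurableSet_singleton _)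
  -- Needed for the comparison: without integrability the drift integral would take the default
  -- value 0.
  have hbI : IntervalIntegrable (fun s : ℝ ↦ b (X s.toNNReal ω) (Z s.toNNReal ω)) volume 0 t :=
    intervalIntegrable_const (c := K) |>.mono_fun
      (hb_meas.comp (hX.prodMk hZ)).aestronglyMeasurable
      (.of_forall fun s ↦ by simpa using (hK _ _).trans (le_abs_self K))
  have hrI : IntervalIntegrable (fun s : ℝ ↦ r (Z s.toNNReal ω)) volume 0 t :=
    intervalIntegrable_const (c := ∑ i, |r i|) |>.mono_fun (hrm 1 one_pos).1.aestronglyMeasurable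
      (.of_forall fun s ↦ by
        exact (Finset.single_le_sum (f := fun i ↦ |r i|) (fun i _ ↦ abs_nonneg _)
          (Finset.mem_univ _)).trans (le_abs_self _))
  have := intervalIntegral.integral_mono_on (NNReal.coe_nonneg t) hrI hbI fun s _ ↦ hr _ _
  rw [heq t]
  linarith

end Diffusion

end SwitchingDiffusion

/-! ### The constants and the two conclusions -/

theorem theorem1 (b : ℝ → Fin 2 → ℝ) (lamPlus lamMinus rPlus rMinus : ℝ)
    (hlamPlus : 0 < lamPlus) (hlamMinus : 0 < lamMinus)
    (hb_meas : Measurable (Function.uncurry b))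
    (hb_bdd : ∃ K : ℝ, ∀ y i, |b y i| ≤ K)
    (hrPlus : 0 < rPlus) (hrMinus : 0 < rMinus)
    (hb_minus : ∀ y, -rMinus ≤ b y 0) (hb_plus : ∀ y, rPlus ≤ b y 1)
    (hr : rMinus / lamMinus < rPlus / lamPlus) :
    ∃ c₀ : ℝ, 0 < c₀ ∧
      (∀ (Ω : Type u) [MeasurableSpace Ω] (P : Measure Ω) [IsProbabilityMeasure P]
          (x : ℝ) (z : Fin 2) (W X : ℝ≥0 → Ω → ℝ) (Z : ℝ≥0 → Ω → Fin 2),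
          SwitchingDiffusion.IsSolution b lamPlus lamMinus x z W X Z P →
          (∀ᵐ ω ∂P, Tendsto (fun t ↦ X t ω) atTop atTop) ∧
          (∀ᵐ ω ∂P, (c₀ : EReal) ≤
            liminf (fun t : ℝ≥0 ↦ ((X t ω / (t : ℝ) : ℝ) : EReal)) atTop)) ∧
      ∀ ε : ℝ, 0 < ε → ∃ κ : ℝ, 0 < κ ∧ κ < 1 ∧ ∃ t₀ : ℝ≥0,
        ∀ (Ω : Type u) [MeasurableSpace Ω] (P : Measure Ω) [IsProbabilityMeasure P]
          (x : ℝ) (z : Fin 2) (W X : ℝ≥0 → Ω → ℝ) (Z : ℝ≥0 → Ω → Fin 2),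
          SwitchingDiffusion.IsSolution b lamPlus lamMinus x z W X Z P →
          ∀ t : ℝ≥0, t₀ ≤ t →
            P.real {ω | (X t ω - x) / (t : ℝ) - c₀ < -ε} < κ ^ (t : ℝ) ∧ κ ^ (t : ℝ) < 1 := by
  obtain ⟨K, hK⟩ := hb_bdd
  obtain ⟨h, θ, c, hpos, hθ, hc, hdiss⟩ :=
    SwitchingDiffusion.exists_tilt_dissipative hlamPlus hlamMinus hrPlus hrMinus hr
  set r : Fin 2 → ℝ := ![-rMinus, rPlus]
  have hrb : ∀ y i, r i ≤ b y i := by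
    intro y i
    fin_cases i
    · exact hb_minus y
    · exact hb_plus y
  have hstep := SwitchingDiffusion.eventually_sum_transition_le _ r h θ c hdiss
  obtain ⟨η, hη, hh⟩ : ∃ η : ℝ, 0 < η ∧ ∀ i, η ≤ h i := by
    refine ⟨min (h 0) (h 1), lt_min (hpos 0) (hpos 1), fun i ↦ ?_⟩
    fin_cases i
    · exact min_le_left _ _
    · exact min_le_right _ _
  set a := c / (2 * θ) with ha
  have ha0 : 0 < a := by positivity
  -- A grows at rate at least a; half of this is given up to absorb the noise.
  refine ⟨a / 2, by positivity, ?_, ?_⟩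
  · intro Ω _ P _ x z W X Z hS
    obtain ⟨M, hM⟩ := hS.chain.ae_eventually_le_integral hθ hc hη hh hstep
    -- Eventually W_t > -(a/4)t, so X grows at rate 3a/4. The remaining a/4 above c₀ absorbs the
    -- constant x - M.
    have hgrow : ∀ᵐ ω ∂P, ∀ᶠ t : ℝ≥0 in atTop, x - M + 3 * a / 4 * t ≤ X t ω := by
      filter_upwards [hM, hS.ae_integral_add_le hb_meas hK hrb,
        SwitchingDiffusion.ae_tendsto_brownian_div hS.brownian hS.measurable_noise]
        with ω h1 h2 h3
      filter_upwards [h1, h3.eventually_const_lt (show -(a / 4) < 0 by linarith),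
        eventually_gt_atTop 0] with t h4 h5 h6
      rw [lt_div_iff₀ (NNReal.coe_pos.2 h6)] at h5
      have := h2 t
      linarith
    constructor
    · filter_upwards [hgrow] with ω hω
      refine tendsto_atTop_mono' _ hω ?_
      exact tendsto_atTop_add_const_left _ _
        ((NNReal.tendsto_coe_atTop.2 tendsto_id).const_mul_atTop (by positivity))
    · filter_upwards [hgrow] with ω hω
      refine le_liminf_of_le (by isBoundedDefault) ?_
      filter_upwards [hω, eventually_gt_atTop 0,
        (NNReal.tendsto_coe_atTop.2 tendsto_id).eventually_ge_atTop (4 / a * (M - x))]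
        with t h1 h2 h3
      rw [EReal.coe_le_coe_iff, le_div_iff₀ (NNReal.coe_pos.2 h2)]
      have h4 : a / 4 * (4 / a * (M - x)) ≤ a / 4 * t := by gcongr; exact h3
      have h5 : a / 4 * (4 / a * (M - x)) = M - x := by field_simp
      linarith
  · intro ε hε
    -- Both tails decay at rate at least 2γ. Claiming only rate γ leaves a factor exp(γt) to beat
    -- the constant B.
    set γ := min (c / 2) ((a / 2) ^ 2 / 2) / 2 with hγ
    have hγ0 : 0 < γ := by positivity
    have hγc : 2 * γ ≤ c / 2 := by rw [hγ]; linarith [min_le_left (c / 2) ((a / 2) ^ 2 / 2)]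
    have hγa : 2 * γ ≤ (a / 2) ^ 2 / 2 := by
      rw [hγ]; linarith [min_le_right (c / 2) ((a / 2) ^ 2 / 2)]
    -- The sum h 0 + h 1 bounds the Chernoff prefactor for either initial regime, which makes t₀
    -- independent of z; the 1 is the Gaussian term.
    set B := (h 0 + h 1) / η + 1
    have hB : 0 < B := by have := hpos 0; have := hpos 1; positivity
    refine ⟨Real.exp (-γ), Real.exp_pos _, Real.exp_lt_one_iff.2 (by linarith),
      (Real.log B / γ + 1).toNNReal ⊔ 1, ?_⟩
    intro Ω _ P _ x z W X Z hS t ht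
    have ht1 : (1 : ℝ) ≤ t := by exact_mod_cast (le_sup_right.trans ht)
    have ht0 : 0 < t := by rw [← NNReal.coe_pos]; linarith
    have htB : Real.log B / γ + 1 ≤ t := Real.toNNReal_le_iff_le_coe.1 (le_sup_left.trans ht)
    have hBt : B < Real.exp (γ * t) := by
      rw [← Real.log_lt_iff_lt_exp hB, mul_comm, ← div_lt_iff₀ hγ0]
      linarith
    refine ⟨?_, Real.rpow_lt_one (Real.exp_pos _).le (Real.exp_lt_one_iff.2 (by linarith))
      (by linarith)⟩
    -- The margin ε is discarded: X_t - x < (a/2)t already forces one of the two bad events, so κ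
    -- does not depend on ε.
    have hsub : {ω | (X t ω - x) / (t : ℝ) - a / 2 < -ε} ≤ᵐ[P]
        ({ω | ∫ s in (0 : ℝ)..t, r (Z s.toNNReal ω) ≤ a * t} ∪
          {ω | W t ω ≤ -(a / 2) * t} : Set Ω) := by
      filter_upwards [hS.ae_integral_add_le hb_meas hK hrb] with ω h1 h2
      have h3 : (X t ω - x) / (t : ℝ) < a / 2 := by
        have : (X t ω - x) / (t : ℝ) - a / 2 < -ε := h2
        linarith
      rw [div_lt_iff₀ (by linarith)] at h3
      by_contra hcon
      obtain ⟨h4, h5⟩ : a * t < ∫ s in (0 : ℝ)..t, r (Z s.toNNReal ω) ∧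
          -(a / 2) * t < W t ω :=
        ⟨not_le.1 fun h ↦ hcon (Or.inl h), not_le.1 fun h ↦ hcon (Or.inr h)⟩
      linarith [h1 t]
    have hA := hS.chain.measureReal_integral_le hθ hη hh hstep ht0 (a * t)
    have hW := SwitchingDiffusion.measureReal_brownian_le hS.brownian.toIsPreBrownianReal t
      (show 0 ≤ a / 2 by positivity)
    have hhz : h z ≤ h 0 + h 1 := by
      fin_cases z
      · exact le_add_of_nonneg_right (hpos 1).le
      · exact le_add_of_nonneg_left (hpos 0).le
    have e1 : θ * (a * t) - c * t = -(c / 2) * t := by rw [ha]; field_simp; ring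
    rw [e1] at hA
    calc _ ≤ P.real ({ω | ∫ s in (0 : ℝ)..t, r (Z s.toNNReal ω) ≤ a * t} ∪
          {ω | W t ω ≤ -(a / 2) * t} : Set Ω) :=
          ENNReal.toReal_mono (measure_ne_top _ _) (measure_mono_ae hsub)
      _ ≤ _ := measureReal_union_le _ _
      _ ≤ (h 0 + h 1) / η * Real.exp (-(2 * γ) * t) + Real.exp (-(2 * γ) * t) := by
          refine add_le_add (hA.trans ?_) (hW.trans ?_)
          · gcongr
            exact div_nonneg (add_nonneg (hpos 0).le (hpos 1).le) hη.le
          · rw [Real.exp_le_exp]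
            gcongr
            linarith
      _ = B * Real.exp (-(2 * γ) * t) := by ring
      _ < Real.exp (γ * t) * Real.exp (-(2 * γ) * t) := by gcongr
      _ = Real.exp (-γ) ^ (t : ℝ) := by
          rw [← Real.exp_mul, ← Real.exp_add]
          ring_nf
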